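/- Conventions. Let $R$ be an associative ring with identity. Complexes of $R$-modules are indexed homologically by $\mathbb Z$ and are regarded as objects of the derived category $\mathrm D(R)$, so $M\not\simeq0$ means that $\mathrm H(M)\neq0$. Put $\sup P=\sup\{i\mid P_i\ne0\}$, $\mathrm{hsup}\,P=\sup\{i\mid \mathrm H_i(P)\neq0\}$, and let $\Sigma$ denote the shift, $(\Sigma M)_j=M_{j-1}$. A complex $P$ is bounded above if $P_i=0$ for all $i\gg0$. It is semi-projective if $\mathrm{Hom}_R(P,\beta)$ is a surjective quasi-isomorphism for every surjective quasi-isomorphism $\beta$ of complexes of $R$-modules. A quasi-projective resolution of a complex $M$ is a semi-projective complex $P$ for which there are an integer $\ell$ and integers $a_i\ge0$ ($i\ge\ell$), not all zero, with $\mathrm H(P)\cong\bigoplus_{i\ge\ell}\mathrm H(\Sigma^iM^{a_i})$ as graded $R$-modules. The quasi-projective dimension of a complex $M\not\simeq0$ is $$\mathrm{qpd}_RM=\inf\{\sup P-\mathrm{hsup}\,P\mid P\text{ is a bounded above quasi-projective resolution of }M\}$$ (so $\mathrm{qpd}_RM=\infty$ if there is no such $P$), and $\mathrm{qpd}_RM=-\infty$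 if $M\simeq0$. Proposition. Let $R$ be a commutative ring, let $\mathbf x=x_1,\dots,x_d$ be an $R$-regular sequence, and let $M\not\simeq0$ be a complex of $R/(\mathbf x)$-modules with bounded homology (that is, $\mathrm H_i(M)=0$ for all but finitely many $i$). Then there is an integer $N\ge1$ such that for all $n\ge N$ $$\mathrm{qpd}_{R/(x_1^n,\dots,x_d^n)}M\le\mathrm{qpd}_RM-d ,$$ where $M$ is viewed as a complex over $R$ and over $R/(x_1^n,\dots,x_d^n)$ by restriction of scalars along $R\to R/(x_1^n,\dots,x_d^n)\to R/(\mathbf x)$, and $\infty-d=\infty$. -/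

import Mathlib

open CategoryTheory CategoryTheory.Limits

universe u

/-!
Complexes of `R`-modules are cochain complexes indexed by `ℤ`. The homological degree `i` of the
literature is the cohomological degree `-i`, that is `M_i = M^{-i}` and `H_i(M) = H^{-i}(M)`.
Objects of the derived category `D(R)` are represented by complexes.
-/

namespace QuasiProjective

section Resolutions

variable {R : Type u} [Ring R]

/-- The map `Hom(P, β) : Hom(P, K) ⟶ Hom(P, L)` of Hom complexes induced by `β : K ⟶ L`. -/
noncomputable def homComplexMap (P : CochainComplex (ModuleCat.{u} R) ℤ)
    {K L : CochainComplex (ModuleCat.{u} R) ℤ} (β : K ⟶ L) :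
    CochainComplex.HomComplex P K ⟶ CochainComplex.HomComplex P L where
  f n := AddCommGrpCat.ofHom
    { toFun := fun z : CochainComplex.HomComplex.Cochain P K n =>
        z.comp (CochainComplex.HomComplex.Cochain.ofHom β) (add_zero n)
      map_zero' := by simp
      map_add' := by intro x y; simp }
  comm' i j _ := by
    ext z
    exact CochainComplex.HomComplex.δ_comp_ofHom z β j

/-- `P` is semi-projective: `Hom(P, β)` is a surjective quasi-isomorphism for every surjective
quasi-isomorphism `β` of complexes of modules. -/
def IsSemiProjective (P : CochainComplex (ModuleCat.{u} R) ℤ) : Prop :=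
  ∀ ⦃K L : CochainComplex (ModuleCat.{u} R) ℤ⦄ (β : K ⟶ L),
    (∀ k : ℤ, Function.Surjective (β.f k)) → QuasiIso β →
      (∀ k : ℤ, Function.Surjective ((homComplexMap P β).f k)) ∧ QuasiIso (homComplexMap P β)

/-- `P` is a quasi-projective resolution of `M`: it is semi-projective and there are an integer
`ℓ` and natural numbers `a i` for `i ≥ ℓ`, not all zero, such that the graded modules `H(P)` and
`⨁_{i ≥ ℓ} H(Σ^i M^{a i})` are isomorphic. In cohomological degree `k` the right-hand side is
`⨁_{i ≥ ℓ} (H^{k+i}(M))^{a i}`. -/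
def IsQuasiProjectiveResolution (P M : CochainComplex (ModuleCat.{u} R) ℤ) : Prop :=
  IsSemiProjective P ∧
    ∃ (ℓ : ℤ) (a : ℤ → ℕ), (∃ i : ℤ, ℓ ≤ i ∧ a i ≠ 0) ∧
      ∀ k : ℤ, Nonempty
        ((P.homology k) ≃ₗ[R]
          DirectSum {i : ℤ // ℓ ≤ i} fun i => (Fin (a i) → M.homology (k + i)))

/-- `sup P = sup {i | P_i ≠ 0}`, where `P_i = P^{-i}`. -/
noncomputable def supDegree (P : CochainComplex (ModuleCat.{u} R) ℤ) : EReal :=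
  sSup {e : EReal | ∃ i : ℤ, ¬ IsZero (P.X (-i)) ∧ e = ((i : ℝ) : EReal)}

/-- `hsup P = sup {i | H_i(P) ≠ 0}`, where `H_i(P) = H^{-i}(P)`. -/
noncomputable def hsupDegree (P : CochainComplex (ModuleCat.{u} R) ℤ) : EReal :=
  sSup {e : EReal | ∃ i : ℤ, ¬ IsZero (P.homology (-i)) ∧ e = ((i : ℝ) : EReal)}

/-- `P` is bounded above: `P_i = P^{-i}` vanishes for all large `i`. -/
def IsBoundedAbove (P : CochainComplex (ModuleCat.{u} R) ℤ) : Prop :=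
  ∃ s : ℤ, ∀ i : ℤ, s < i → IsZero (P.X (-i))

/-- The homology of `M` is bounded: `M` belongs to `D_□(R)`. -/
def HasBoundedHomology (M : CochainComplex (ModuleCat.{u} R) ℤ) : Prop :=
  ∃ s : ℤ, ∀ i : ℤ, s < |i| → IsZero (M.homology i)

open Classical in
/-- The quasi-projective dimension of the complex `M`, with values in the extended reals. It is
`⊥` if `M` is exact, and `⊤` if `M` has no bounded above quasi-projective resolution. -/
noncomputable def qpd (M : CochainComplex (ModuleCat.{u} R) ℤ) : EReal :=
  if M.Acyclic then ⊥ else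
    sInf {e : EReal | ∃ P : CochainComplex (ModuleCat.{u} R) ℤ,
      IsQuasiProjectiveResolution P M ∧ IsBoundedAbove P ∧ e = supDegree P - hsupDegree P}

end Resolutions

/-- Restriction of scalars of complexes of modules along a ring homomorphism. -/
noncomputable def restrictComplex {A B : Type u} [Ring A] [Ring B] (f : A →+* B)
    (M : CochainComplex (ModuleCat.{u} B) ℤ) : CochainComplex (ModuleCat.{u} A) ℤ :=
  ((ModuleCat.restrictScalars f).mapHomologicalComplex (ComplexShape.up ℤ)).obj M

section Ideals

variable {R : Type u} [CommRing R] {d : ℕ}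

/-- The ideal `(x_1, …, x_d)`. -/
def seqIdeal (x : Fin d → R) : Ideal R := Ideal.span (Set.range x)

/-- For `n ≥ 1` the ideal `(x_1^n, …, x_d^n)` is contained in `(x_1, …, x_d)`. -/
theorem seqIdeal_pow_le (x : Fin d → R) {n : ℕ} (hn : 1 ≤ n) :
    seqIdeal (fun i => x i ^ n) ≤ seqIdeal x := by
  unfold seqIdeal
  rw [Ideal.span_le]
  rintro _ ⟨i, rfl⟩
  exact Ideal.pow_mem_of_mem _ (Ideal.subset_span (Set.mem_range_self i)) n hn

end Ideals

end QuasiProjective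

/-!
Choose a bounded above quasi-projective resolution `P` of `M` over `R` attaining `qpd_R M`; this is
possible since the values `sup P - hsup P` are natural numbers. Only finitely many shifts of `M`
occur in `H(P)`, so `H(P)` is bounded, and it is killed by every `x_i`. By the ghost lemma
`nonempty_homotopy_pow_smul`, multiplication by `x_i ^ n` on `P` is null-homotopic for all large
`n`: a morphism from a semi-projective complex to a complex whose homology is killed by `x` and
lives in `w` consecutive degrees becomes null-homotopic after multiplication by `x ^ w`.

For such `n`, the complex `R / (x_1 ^ n, …, x_d ^ n) ⊗ P` resolves `M` over the quotient ring. It is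
semi-projective by adjunction (`IsSemiProjective.extendComplex`). The terms of `P` are projective,
so the powers, which again form a weakly regular sequence (`isWeaklyRegular_map_pow`), are weakly
regular on them. Reduction modulo a non-zero-divisor `y` acting null-homotopically replaces
`H^k` by `H^k × H^{k+1}` (`nonempty_homology_quotient_equiv`), and the null-homotopies descend to the
quotient. Hence the homology of `R / (x_1 ^ n, …, x_d ^ n) ⊗ P` is a finite product of shifts of
`H(P)`, one of them by `d` (`exists_homology_extendComplex_equiv`). So it is a finite product of
shifts of `H(M)`, its `hsup` is at least `hsup P + d`, and its `sup` is at most `sup P`.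

Sums of finitely many shifts of a graded module `H` are handled in the form `∏_j H^{k + e j}`, with
a function `e` from a finite type `J` to `ℤ`.
-/

namespace QuasiProjective

/-! ### Homology of complexes of modules in terms of elements -/

section ElementwiseHomology

variable {R : Type u} [Ring R]

theorem exactAt_iff_forall (K : CochainComplex (ModuleCat.{u} R) ℤ) {i j k : ℤ}
    (hij : i + 1 = j) (hjk : j + 1 = k) :
    K.ExactAt j ↔ ∀ z : K.X j, K.d j k z = 0 → ∃ w : K.X i, K.d i j w = z := by
  have hi : (ComplexShape.up ℤ).prev j = i := by subst hij; simp
  have hk : (ComplexShape.up ℤ).next j = k := by subst hjk; simp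
  rw [K.exactAt_iff' i j k hi hk, ShortComplex.moduleCat_exact_iff]
  rfl

theorem exists_ker_presentation (S : ShortComplex (ModuleCat.{u} R)) :
    ∃ κ : LinearMap.ker S.g.hom →ₗ[R] S.homology, Function.Surjective κ ∧
      ∀ z, κ z = 0 ↔ ∃ w : S.X₁, S.f w = (z : S.X₂) := by
  let κ : LinearMap.ker S.g.hom →ₗ[R] S.homology :=
    (S.moduleCatLeftHomologyData.π ≫ S.moduleCatHomologyIso.inv).hom
  have hinj : Function.Injective S.moduleCatHomologyIso.inv :=
    S.moduleCatHomologyIso.symm.toLinearEquiv.injective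
  have hsurj : Function.Surjective S.moduleCatHomologyIso.inv :=
    S.moduleCatHomologyIso.symm.toLinearEquiv.surjective
  refine ⟨κ, hsurj.comp (Submodule.mkQ_surjective (LinearMap.range S.moduleCatToCycles)),
    fun z => ?_⟩
  change S.moduleCatHomologyIso.inv ((LinearMap.range S.moduleCatToCycles).mkQ z) = 0 ↔ _
  refine (map_eq_zero_iff S.moduleCatHomologyIso.inv.hom hinj).trans ?_
  refine (Submodule.Quotient.mk_eq_zero (LinearMap.range S.moduleCatToCycles)).trans ?_
  constructor
  · rintro ⟨w, hw⟩
    exact ⟨w, congrArg Subtype.val hw⟩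
  · rintro ⟨w, hw⟩
    exact ⟨w, Subtype.ext hw⟩

/-- Homology is the quotient of cycles by boundaries, phrased as a surjection from the cycles. -/
theorem exists_cycles_presentation (K : CochainComplex (ModuleCat.{u} R) ℤ) {i j k : ℤ}
    (hij : i + 1 = j) (hjk : j + 1 = k) :
    ∃ κ : LinearMap.ker (K.d j k).hom →ₗ[R] K.homology j, Function.Surjective κ ∧
      ∀ z, κ z = 0 ↔ ∃ w : K.X i, K.d i j w = (z : K.X j) := by
  have hi : (ComplexShape.up ℤ).prev j = i := by subst hij; simp
  have hk : (ComplexShape.up ℤ).next j = k := by subst hjk; simp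
  let e : (K.sc' i j k).homology ≃ₗ[R] K.homology j :=
    (K.homologyIsoSc' i j k hi hk).symm.toLinearEquiv
  obtain ⟨κ, hκ, hκ'⟩ := exists_ker_presentation (K.sc' i j k)
  exact ⟨e.toLinearMap.comp κ, e.surjective.comp hκ, fun z => e.map_eq_zero_iff.trans (hκ' z)⟩

theorem d_d_apply (K : CochainComplex (ModuleCat.{u} R) ℤ) (i j k : ℤ) (w : K.X i) :
    K.d j k (K.d i j w) = 0 := by
  rw [← ConcreteCategory.comp_apply, K.d_comp_d]; rfl

theorem hom_f_d_apply {K L : CochainComplex (ModuleCat.{u} R) ℤ} (f : K ⟶ L) (i j : ℤ)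
    (w : K.X i) : f.f j (K.d i j w) = L.d i j (f.f i w) := by
  rw [← ConcreteCategory.comp_apply, ← f.comm, ConcreteCategory.comp_apply]

theorem homotopy_apply {P X : CochainComplex (ModuleCat.{u} R) ℤ} {f : P ⟶ X}
    (h : Homotopy f 0) {i j k : ℤ} (hij : i + 1 = j) (hjk : j + 1 = k) (p : P.X j) :
    f.f j p = h.hom k j (P.d j k p) + X.d i j (h.hom j i p) := by
  have := h.comm j
  rw [dNext_eq h.hom (show (ComplexShape.up ℤ).Rel j k from hjk),
    prevD_eq h.hom (show (ComplexShape.up ℤ).Rel i j from hij)] at this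
  rw [this]
  simp

theorem acyclic_iff_forall_isZero_homology (K : CochainComplex (ModuleCat.{u} R) ℤ) :
    K.Acyclic ↔ ∀ k, IsZero (K.homology k) :=
  forall_congr' fun _ => HomologicalComplex.exactAt_iff_isZero_homology _ _

theorem isZero_homology_of_isZero (P : CochainComplex (ModuleCat.{u} R) ℤ) {k : ℤ}
    (h : IsZero (P.X k)) : IsZero (P.homology k) := by
  rw [← HomologicalComplex.exactAt_iff_isZero_homology]
  exact (exactAt_iff_forall P (sub_add_cancel k 1) rfl).2 fun z _ =>
    ⟨0, (ModuleCat.isZero_iff_subsingleton.1 h).elim _ _⟩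

end ElementwiseHomology

/-! ### Reduction modulo one element acting null-homotopically -/

section NullHomotopicMultiplication

variable {R : Type u} [CommRing R]

/-- If `y` is a non-zero-divisor on `Q` and multiplication by `y` is null-homotopic, then the long
exact homology sequence of `0 → Q → Q → Q/yQ → 0` splits: a null-homotopy `s` of `y` induces
the section `z ↦ [s z]` of the connecting map. The isomorphism sends a pair of cycles `(p, q)` to
the class of `p + s q`. -/
theorem nonempty_homology_quotient_equiv {Q Q' : CochainComplex (ModuleCat.{u} R) ℤ} (π : Q ⟶ Q')
    (y : R) (hπ : ∀ i, Function.Surjective (π.f i))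
    (hker : ∀ i (q : Q.X i), π.f i q = 0 ↔ ∃ v : Q.X i, y • v = q)
    (hreg : ∀ i, IsSMulRegular (Q.X i) y) (h : Homotopy (y • 𝟙 Q) 0) (k : ℤ) :
    Nonempty (Q'.homology k ≃ₗ[R] Q.homology k × Q.homology (k + 1)) := by
  obtain ⟨i, hik⟩ : ∃ i, i + 1 = k := ⟨k - 1, by ring⟩
  have hs : ∀ {a b c : ℤ} (_ : a + 1 = b) (_ : b + 1 = c) (q : Q.X b),
      y • q = h.hom c b (Q.d b c q) + Q.d a b (h.hom b a q) := fun hab hbc q => by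
    simpa using homotopy_apply h hab hbc q
  obtain ⟨κ₀, hκ₀, hκ₀'⟩ := exists_cycles_presentation Q hik (rfl : k + 1 = k + 1)
  obtain ⟨κ₁, hκ₁, hκ₁'⟩ := exists_cycles_presentation Q (rfl : k + 1 = k + 1)
    (rfl : k + 1 + 1 = k + 1 + 1)
  obtain ⟨κ, hκ, hκ'⟩ := exists_cycles_presentation Q' hik (rfl : k + 1 = k + 1)
  -- Both sides are quotients of the pairs of cycles `(p, q)`; `p + s q` is a cycle modulo `y` since
  -- `d (s q) = y q`.
  have hπy : ∀ a (v : Q.X a), π.f a (y • v) = 0 := fun a v => (hker a _).2 ⟨v, rfl⟩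
  let Z := LinearMap.ker (Q.d k (k + 1)).hom × LinearMap.ker (Q.d (k + 1) (k + 1 + 1)).hom
  let g : Z →ₗ[R] Q.X k :=
    (LinearMap.ker (Q.d k (k + 1)).hom).subtype.comp (LinearMap.fst R _ _) +
      (h.hom (k + 1) k).hom.comp
        ((LinearMap.ker (Q.d (k + 1) (k + 1 + 1)).hom).subtype.comp (LinearMap.snd R _ _))
  have hg : ∀ z : Z, g z = z.1.1 + h.hom (k + 1) k z.2.1 := fun z => rfl
  have hdg : ∀ z : Z, Q.d k (k + 1) (g z) = y • z.2.1 := by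
    intro z
    have h1 : Q.d k (k + 1) z.1.1 = 0 := z.1.2
    have h2 : Q.d (k + 1) (k + 1 + 1) z.2.1 = 0 := z.2.2
    rw [hg, map_add, h1, hs rfl rfl, h2, map_zero, zero_add]
  let G : Z →ₗ[R] LinearMap.ker (Q'.d k (k + 1)).hom :=
    LinearMap.codRestrict _ ((π.f k).hom.comp g) fun z => by
      change Q'.d k (k + 1) (π.f k (g z)) = 0
      rw [← hom_f_d_apply, hdg, hπy]
  have hG : ∀ z : Z, (G z : Q'.X k) = π.f k (g z) := fun z => rfl
  have hsurj : Function.Surjective (κ.comp G) := by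
    intro c
    obtain ⟨⟨z', hz'⟩, rfl⟩ := hκ c
    obtain ⟨w, rfl⟩ := hπ k z'
    have : π.f (k + 1) (Q.d k (k + 1) w) = 0 := by rw [hom_f_d_apply]; exact hz'
    obtain ⟨q, hq⟩ := (hker _ _).1 this
    have hdq : Q.d (k + 1) (k + 1 + 1) q = 0 := by
      apply hreg
      change y • _ = y • (0 : Q.X _)
      rw [← map_smul, hq, d_d_apply, smul_zero]
    have hp : Q.d k (k + 1) (w - h.hom (k + 1) k q) = 0 := by
      rw [map_sub, ← hq, hs rfl rfl, hdq, map_zero, zero_add, sub_self]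
    refine ⟨(⟨_, hp⟩, ⟨q, hdq⟩), ?_⟩
    rw [LinearMap.comp_apply]
    congr 1
    apply Subtype.ext
    rw [hG, hg]
    simp
  have hkereq : LinearMap.ker (κ.comp G) = LinearMap.ker (κ₀.prodMap κ₁) := by
    ext z
    rw [LinearMap.mem_ker, LinearMap.mem_ker, LinearMap.comp_apply, hκ', hG, LinearMap.prodMap_apply,
      Prod.mk_eq_zero, hκ₀', hκ₁']
    constructor
    · rintro ⟨u', hu'⟩
      obtain ⟨u, rfl⟩ := hπ _ u'
      rw [← hom_f_d_apply, ← sub_eq_zero, ← map_sub, hker] at hu'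
      obtain ⟨v, hv⟩ := hu'
      have hq : z.2.1 = Q.d k (k + 1) (-v) := by
        apply hreg
        change y • _ = y • _
        rw [← map_smul, smul_neg, hv, map_neg, map_sub, d_d_apply, hdg, zero_sub, neg_neg]
      refine ⟨?_, ⟨-v, hq.symm⟩⟩
      refine ⟨u - h.hom k i v, ?_⟩
      have h3 : z.1.1 = g z - h.hom (k + 1) k z.2.1 := by rw [hg]; simp
      have h4 := hs hik (rfl : k + 1 = k + 1) v
      rw [h3, hq]
      have h5 : g z = Q.d i k u - y • v := by rw [hv]; abel
      rw [h5, h4, map_neg, map_neg, map_sub]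
      abel
    · rintro ⟨⟨u, hu⟩, ⟨r, hr⟩⟩
      refine ⟨π.f i (u - h.hom k i r), ?_⟩
      rw [← hom_f_d_apply, ← sub_eq_zero, ← map_sub, hker, hg, ← hu, ← hr]
      refine ⟨-r, ?_⟩
      rw [smul_neg, hs hik rfl, map_sub]
      abel
  refine ⟨((κ.comp G).quotKerEquivOfSurjective hsurj).symm ≪≫ₗ
    Submodule.quotEquivOfEq _ _ hkereq ≪≫ₗ
    (κ₀.prodMap κ₁).quotKerEquivOfSurjective (hκ₀.prodMap hκ₁)⟩

end NullHomotopicMultiplication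

/-! ### Reduction modulo a weakly regular sequence -/

section QuotientComplex

open scoped Pointwise

variable {R : Type u} [CommRing R]

/-- The functor `M ↦ M / rM`. -/
def quotSMulTopFunctor (r : R) : ModuleCat.{u} R ⥤ ModuleCat.{u} R where
  obj M := ModuleCat.of R (QuotSMulTop r M)
  map f := ModuleCat.ofHom (QuotSMulTop.map r f.hom)
  map_id M := by
    apply ModuleCat.hom_ext
    exact QuotSMulTop.map_id r M
  map_comp f g := by
    apply ModuleCat.hom_ext
    exact QuotSMulTop.map_comp r g.hom f.hom

instance (r : R) : (quotSMulTopFunctor r).Additive where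
  map_add {M N f g} := by
    apply ModuleCat.hom_ext
    exact map_add (QuotSMulTop.map r) f.hom g.hom

instance (r : R) : (quotSMulTopFunctor r).Linear R where
  map_smul {M N} f c := by
    apply ModuleCat.hom_ext
    exact map_smul (QuotSMulTop.map r) c f.hom

/-- The complex `P / rP`. -/
def quotComplex (r : R) (P : CochainComplex (ModuleCat.{u} R) ℤ) :
    CochainComplex (ModuleCat.{u} R) ℤ :=
  ((quotSMulTopFunctor r).mapHomologicalComplex _).obj P

/-- The projection `P ⟶ P / rP`. -/
def quotComplexMk (r : R) (P : CochainComplex (ModuleCat.{u} R) ℤ) : P ⟶ quotComplex r P where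
  f i := ModuleCat.ofHom (Submodule.mkQ (r • (⊤ : Submodule R (P.X i))))
  comm' _ _ _ := rfl

theorem quotComplexMk_surjective (r : R) (P : CochainComplex (ModuleCat.{u} R) ℤ) (i : ℤ) :
    Function.Surjective ((quotComplexMk r P).f i) :=
  Submodule.mkQ_surjective _

theorem quotComplexMk_eq_zero_iff (r : R) (P : CochainComplex (ModuleCat.{u} R) ℤ) (i : ℤ)
    (p : P.X i) : (quotComplexMk r P).f i p = 0 ↔ ∃ v : P.X i, r • v = p := by
  refine (Submodule.Quotient.mk_eq_zero _).trans ?_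
  rw [Submodule.mem_smul_pointwise_iff_exists]
  simp

/-- Multiplication by `y` stays null-homotopic modulo `r`. -/
theorem nonempty_homotopy_quotComplex (r y : R) {P : CochainComplex (ModuleCat.{u} R) ℤ}
    (h : Homotopy (y • 𝟙 P) 0) : Nonempty (Homotopy (y • 𝟙 (quotComplex r P)) 0) := by
  refine ⟨(Homotopy.ofEq ?_).trans (((quotSMulTopFunctor r).mapHomotopy h).trans
    (Homotopy.ofEq ?_))⟩
  · ext i : 1
    simp only [quotComplex, HomologicalComplex.smul_f_apply,
      Functor.map_smul, HomologicalComplex.id_f, CategoryTheory.Functor.map_id]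
    rfl
  · rw [Functor.map_zero]
    rfl

/-- A morphism killing `rP` factors through `P / rP`. -/
def quotComplexDesc (r : R) {P Q : CochainComplex (ModuleCat.{u} R) ℤ} (π : P ⟶ Q)
    (h : ∀ i (v : P.X i), π.f i (r • v) = 0) : quotComplex r P ⟶ Q where
  f i := ModuleCat.ofHom (Submodule.liftQ (r • (⊤ : Submodule R (P.X i))) (π.f i).hom (by
    rintro _ ⟨v, -, rfl⟩
    exact h i v))
  comm' i j _ := by
    apply ModuleCat.hom_ext
    apply LinearMap.ext
    intro c
    obtain ⟨p, rfl⟩ := Submodule.mkQ_surjective _ c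
    exact (hom_f_d_apply π i j p).symm

theorem quotComplexDesc_mk (r : R) {P Q : CochainComplex (ModuleCat.{u} R) ℤ} (π : P ⟶ Q)
    (h : ∀ i (v : P.X i), π.f i (r • v) = 0) (i : ℤ) (p : P.X i) :
    (quotComplexDesc r π h).f i ((quotComplexMk r P).f i p) = π.f i p :=
  rfl

/-- A product of modules each of which splits into two factors. -/
def piSumEquiv {J : Type*} {C : J → Type*} [∀ j, AddCommGroup (C j)] [∀ j, Module R (C j)]
    (A : J ⊕ J → Type*) [∀ s, AddCommGroup (A s)] [∀ s, Module R (A s)]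
    (e : ∀ j, C j ≃ₗ[R] A (Sum.inl j) × A (Sum.inr j)) : (∀ j, C j) ≃ₗ[R] ∀ s, A s where
  toFun f := Sum.rec (fun j => (e j (f j)).1) (fun j => (e j (f j)).2)
  invFun g j := (e j).symm (g (Sum.inl j), g (Sum.inr j))
  map_add' f g := by
    ext s
    rcases s with j | j <;> simp
  map_smul' c f := by
    ext s
    rcases s with j | j <;> simp
  left_inv f := by ext j; simp
  right_inv g := by
    ext s
    rcases s with j | j <;> simp

/-- Reduction of `P` modulo a weakly regular sequence each of whose terms acts null-homotopically:
the homology is a finite product of shifts of the homology of `P`, one of them by the length of the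
sequence. -/
theorem exists_homology_quotient_equiv (rs : List R) :
    ∀ {P Q : CochainComplex (ModuleCat.{u} R) ℤ} (π : P ⟶ Q),
      (∀ i, RingTheory.Sequence.IsWeaklyRegular (P.X i) rs) →
      (∀ r ∈ rs, Nonempty (Homotopy (r • 𝟙 P) 0)) →
      (∀ i, Function.Surjective (π.f i)) →
      (∀ i (p : P.X i), π.f i p = 0 ↔ p ∈ Ideal.ofList rs • (⊤ : Submodule R (P.X i))) →
      ∃ (J : Type) (_ : Fintype J) (e : J → ℤ), (∃ j, e j = rs.length) ∧
        ∀ k, Nonempty (Q.homology k ≃ₗ[R] ∀ j : J, P.homology (k + e j)) := by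
  induction rs with
  | nil =>
    intro P Q π _ _ hπ hker
    have hiso : ∀ i, IsIso (π.f i) := fun i => by
      rw [ConcreteCategory.isIso_iff_bijective]
      refine ⟨(injective_iff_map_eq_zero _).2 fun p hp => ?_, hπ i⟩
      simpa using (hker i p).1 hp
    have : IsIso π := HomologicalComplex.Hom.isIso_of_components π
    refine ⟨Unit, inferInstance, fun _ => 0, ⟨(), by simp⟩, fun k => ⟨?_⟩⟩
    have e1 : Q.homology k ≃ₗ[R] P.homology k :=
      ((HomologicalComplex.homologyFunctor _ _ k).mapIso (asIso π)).symm.toLinearEquiv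
    have e2 : P.homology k ≃ₗ[R] P.homology (k + 0) :=
      (eqToIso (by rw [add_zero])).toLinearEquiv
    exact e1 ≪≫ₗ e2 ≪≫ₗ (LinearEquiv.funUnique Unit R (P.homology (k + 0))).symm
  | cons r rs ih =>
    intro P Q π hreg hnull hπ hker
    have hr : ∀ i (v : P.X i), π.f i (r • v) = 0 := fun i v => by
      rw [hker, Ideal.ofList_cons_smul]
      exact Submodule.mem_sup_left (Submodule.smul_mem_pointwise_smul _ _ _ trivial)
    obtain ⟨h⟩ := hnull r (by simp)
    obtain ⟨J, _, e, ⟨j, hj⟩, he⟩ := ih (quotComplexDesc r π hr)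
      (fun i => ((RingTheory.Sequence.isWeaklyRegular_cons_iff _ _ _).1 (hreg i)).2)
      (fun y hy => by
        obtain ⟨hy⟩ := hnull y (by simp [hy])
        exact nonempty_homotopy_quotComplex r y hy)
      (fun i q => by
        obtain ⟨p, rfl⟩ := hπ i q
        exact ⟨(quotComplexMk r P).f i p, quotComplexDesc_mk r π hr i p⟩)
      (fun i c => by
        obtain ⟨p, rfl⟩ := quotComplexMk_surjective r P i c
        rw [quotComplexDesc_mk, hker, Ideal.ofList_cons_smul]
        change _ ↔ (r • (⊤ : Submodule R (P.X i))).mkQ p ∈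
          Ideal.ofList rs • (⊤ : Submodule R (QuotSMulTop r (P.X i)))
        have htop : Submodule.map (r • (⊤ : Submodule R (P.X i))).mkQ ⊤ = ⊤ := by
          rw [Submodule.map_top, Submodule.range_mkQ]
        rw [← Submodule.mem_comap, ← htop, ← Submodule.map_smul'', Submodule.comap_map_mkQ])
    have hP := nonempty_homology_quotient_equiv (quotComplexMk r P) r
      (quotComplexMk_surjective r P) (quotComplexMk_eq_zero_iff r P)
      (fun i => ((RingTheory.Sequence.isWeaklyRegular_cons_iff _ _ _).1 (hreg i)).1) h
    refine ⟨J ⊕ J, inferInstance, Sum.elim e (fun j => e j + 1), ⟨Sum.inr j, by simp [hj]⟩,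
      fun k => ?_⟩
    obtain ⟨e1⟩ := he k
    have e2 := fun j => (hP (k + e j)).some
    have e3 : ∀ j, P.homology (k + e j + 1) ≃ₗ[R] P.homology (k + (e j + 1)) := fun j =>
      (eqToIso (by rw [add_assoc])).toLinearEquiv
    let A : J ⊕ J → Type u := fun s => P.homology (k + Sum.elim e (fun j => e j + 1) s)
    let e4 : ∀ j, (quotComplex r P).homology (k + e j) ≃ₗ[R] A (Sum.inl j) × A (Sum.inr j) :=
      fun j => (e2 j).trans ((LinearEquiv.refl R _).prodCongr (e3 j))
    exact ⟨e1 ≪≫ₗ piSumEquiv A e4⟩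

end QuotientComplex

/-! ### Semi-projective complexes are K-projective with projective terms -/

section SemiProjective

open CochainComplex.HomComplex
open scoped ZeroObject

variable {R : Type u} [Ring R]

theorem quasiIso_of_acyclic {C : Type*} [Category* C] [Abelian C]
    {K L : CochainComplex C ℤ} (f : K ⟶ L) (hK : K.Acyclic) (hL : L.Acyclic) : QuasiIso f := by
  rw [quasiIso_iff]
  intro i
  rw [quasiIsoAt_iff_exactAt f i (hK i)]
  exact hL i

/-- For acyclic `L` the morphism `L ⟶ 0` is a surjective quasi-isomorphism, so `Hom(P, L)` is exact
in degree `0`. -/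
theorem IsSemiProjective.isKProjective {P : CochainComplex (ModuleCat.{u} R) ℤ}
    (hP : IsSemiProjective P) : P.IsKProjective where
  nonempty_homotopy_zero {L} f hL := by
    let Z : CochainComplex (ModuleCat.{u} R) ℤ := 0
    have hZ : ∀ i, IsZero (Z.X i) := fun i =>
      (HomologicalComplex.eval _ _ i).map_isZero (isZero_zero _)
    have hZsub : ∀ i (z : Z.X i), z = 0 := fun i z =>
      (ModuleCat.isZero_iff_subsingleton.1 (hZ i)).elim _ _
    have hZa : Z.Acyclic := fun i =>
      (exactAt_iff_forall Z (sub_add_cancel i 1) rfl).2 fun z _ => ⟨0, by rw [hZsub i z, map_zero]⟩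
    obtain ⟨-, hq⟩ := hP (0 : L ⟶ Z) (fun k z => ⟨0, (hZsub k _).trans (hZsub k z).symm⟩)
      (quasiIso_of_acyclic _ hL hZa)
    have hsub : ∀ z w : Cochain P Z 0, z = w := fun z w => by
      ext p q
      exact hZsub _ _ |>.trans (hZsub _ _).symm
    have hex : (CochainComplex.HomComplex P L).ExactAt 0 := by
      rw [exactAt_iff_of_quasiIsoAt (homComplexMap P (0 : L ⟶ Z)) 0,
        HomologicalComplex.exactAt_iff' _ (-1) 0 1 (by simp) (by simp), ShortComplex.ab_exact_iff]
      exact fun z _ => ⟨0, hsub _ _⟩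
    rw [HomologicalComplex.exactAt_iff' _ (-1) 0 1 (by simp) (by simp),
      ShortComplex.ab_exact_iff] at hex
    obtain ⟨z, hz⟩ := hex (Cochain.ofHom f) (δ_ofHom f)
    refine ⟨(Cochain.equivHomotopy f 0).symm ⟨z, ?_⟩⟩
    rw [Cochain.ofHom_zero, add_zero]
    exact hz.symm

/-- The contractible complex with `A × A` in each degree and differential `(a, b) ↦ (b, 0)`. -/
noncomputable def contractible (A : ModuleCat.{u} R) : CochainComplex (ModuleCat.{u} R) ℤ where
  X _ := ModuleCat.of R (A × A)
  d i j := if i + 1 = j then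
    ModuleCat.ofHom ((LinearMap.inl R A A).comp (LinearMap.snd R A A)) else 0
  shape i j h := if_neg h
  d_comp_d' i j k hij hjk := by
    rw [if_pos (show i + 1 = j from hij), if_pos (show j + 1 = k from hjk)]
    rfl

theorem contractible_d_apply (A : ModuleCat.{u} R) {i j : ℤ} (h : i + 1 = j) (a : A × A) :
    (contractible A).d i j a = ((a.2, 0) : A × A) := by
  have : (contractible A).d i j =
    ModuleCat.ofHom ((LinearMap.inl R A A).comp (LinearMap.snd R A A)) := if_pos h
  rw [this]
  rfl

theorem contractible_acyclic (A : ModuleCat.{u} R) : (contractible A).Acyclic := fun i =>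
  (exactAt_iff_forall _ (sub_add_cancel i 1) rfl).2 fun z hz => by
    refine ⟨((0, z.1) : A × A), ?_⟩
    have h1 := contractible_d_apply A (sub_add_cancel i 1) (0, z.1)
    have h2 := (contractible_d_apply A (rfl : i + 1 = i + 1) z).symm.trans hz
    have h3 : z.2 = 0 := congrArg Prod.fst h2
    exact h1.trans (Prod.ext rfl h3.symm)

/-- The morphism of contractible complexes induced by a linear map. -/
noncomputable def contractibleMap {A B : ModuleCat.{u} R} (f : A ⟶ B) :
    contractible A ⟶ contractible B where
  f _ := ModuleCat.ofHom (f.hom.prodMap f.hom)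
  comm' i j h := by
    apply ModuleCat.hom_ext
    apply LinearMap.ext
    intro a
    have h1 := contractible_d_apply B h (f a.1, f a.2)
    have h2 := contractible_d_apply A h a
    change (contractible B).d i j ((f a.1, f a.2) : B × B) =
      (f.hom.prodMap f.hom) ((contractible A).d i j a)
    rw [h2]
    refine h1.trans (Prod.ext rfl ?_)
    exact (map_zero f.hom).symm

/-- The terms of a semi-projective complex are projective: a lifting problem for `P.X k` is a
lifting problem for a cochain of degree `0` with values in contractible complexes. -/
theorem IsSemiProjective.projective {P : CochainComplex (ModuleCat.{u} R) ℤ}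
    (hP : IsSemiProjective P) (k : ℤ) : Module.Projective R (P.X k) := by
  refine (IsProjective.iff_projective (P := P.X k)).2 ?_
  refine ⟨fun {E X} g f _ => ?_⟩
  have hf : Function.Surjective f := (ModuleCat.epi_iff_surjective f).1 inferInstance
  obtain ⟨hs, -⟩ := hP (contractibleMap f) (fun _ => hf.prodMap hf)
    (quasiIso_of_acyclic _ (contractible_acyclic _) (contractible_acyclic _))
  let φ : P.X k ⟶ (contractible X).X k :=
    ModuleCat.ofHom ((LinearMap.inl R X X).comp g.hom)
  obtain ⟨z, hz⟩ := hs 0 (Cochain.single φ 0)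
  have hz' := Cochain.congr_v hz k k (add_zero k)
  rw [Cochain.single_v] at hz'
  let ψ : P.X k ⟶ (contractible E).X k := Cochain.v z k k (add_zero k)
  have h1 : ψ ≫ (contractibleMap f).f k = φ := by
    rw [← hz']
    exact (Cochain.comp_zero_cochain_v z (Cochain.ofHom (contractibleMap f)) k k (add_zero k)).symm
      |>.trans (by rfl)
  refine ⟨ModuleCat.ofHom ((LinearMap.fst R E E).comp ψ.hom), ?_⟩
  apply ModuleCat.hom_ext
  apply LinearMap.ext
  intro p
  exact congrArg (fun χ : P.X k ⟶ (contractible X).X k => (χ p).1) h1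

end SemiProjective

/-! ### Subcomplexes and quotient complexes -/

section Subcomplexes

variable {R : Type u} [Ring R] (K : CochainComplex (ModuleCat.{u} R) ℤ)
  (S : ∀ i, Submodule R (K.X i)) (hS : ∀ i j, ∀ s ∈ S i, K.d i j s ∈ S j)

/-- The subcomplex of `K` given by submodules stable under the differential. -/
def subcomplex : CochainComplex (ModuleCat.{u} R) ℤ where
  X i := ModuleCat.of R (S i)
  d i j := ModuleCat.ofHom ((K.d i j).hom.restrict (hS i j))
  shape i j h := by
    apply ModuleCat.hom_ext
    apply LinearMap.ext
    intro s
    apply Subtype.ext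
    change K.d i j s.1 = 0
    rw [K.shape i j h]
    rfl
  d_comp_d' i j k _ _ := by
    apply ModuleCat.hom_ext
    apply LinearMap.ext
    intro s
    exact Subtype.ext (d_d_apply K i j k s.1)

/-- The inclusion of a subcomplex. -/
def subcomplexι : subcomplex K S hS ⟶ K where
  f i := ModuleCat.ofHom (S i).subtype
  comm' _ _ _ := rfl

/-- The quotient of `K` by a subcomplex. -/
def subcomplexQuotient : CochainComplex (ModuleCat.{u} R) ℤ where
  X i := ModuleCat.of R (K.X i ⧸ S i)
  d i j := ModuleCat.ofHom ((S i).mapQ (S j) (K.d i j).hom (hS i j))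
  shape i j h := by
    apply ModuleCat.hom_ext
    apply LinearMap.ext
    intro c
    obtain ⟨z, rfl⟩ := (S i).mkQ_surjective c
    change (S j).mkQ (K.d i j z) = 0
    rw [K.shape i j h]
    exact map_zero (S j).mkQ
  d_comp_d' i j k _ _ := by
    apply ModuleCat.hom_ext
    apply LinearMap.ext
    intro c
    obtain ⟨z, rfl⟩ := (S i).mkQ_surjective c
    change (S k).mkQ (K.d j k (K.d i j z)) = 0
    rw [d_d_apply, map_zero]

/-- The projection onto the quotient by a subcomplex. -/
def subcomplexπ : K ⟶ subcomplexQuotient K S hS where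
  f i := ModuleCat.ofHom (S i).mkQ
  comm' _ _ _ := rfl

variable {K}

/-- A morphism from a K-projective complex of projective modules can be deformed into a subcomplex
with acyclic quotient. -/
theorem exists_nullHomotopic_sub_mem {P : CochainComplex (ModuleCat.{u} R) ℤ}
    (hP : P.IsKProjective) (hproj : ∀ i, Module.Projective R (P.X i))
    (hT : (subcomplexQuotient K S hS).Acyclic) (f : P ⟶ K) :
    ∃ ν : P ⟶ K, Nonempty (Homotopy ν 0) ∧ ∀ j (p : P.X j), (f - ν).f j p ∈ S j := by
  obtain ⟨h⟩ := hP.nonempty_homotopy_zero (f ≫ subcomplexπ K S hS) hT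
  have hlift : ∀ i j, ∃ s : P.X i →ₗ[R] K.X j, (S j).mkQ.comp s = (h.hom i j).hom := fun i j =>
    Module.projective_lifting_property (S j).mkQ (h.hom i j).hom (S j).mkQ_surjective
  choose s hs using hlift
  refine ⟨Homotopy.nullHomotopicMap' fun i j _ => ModuleCat.ofHom (s i j),
    ⟨Homotopy.nullHomotopy' _⟩, fun j p => ?_⟩
  have h1 := homotopy_apply h (sub_add_cancel j 1) (rfl : j + 1 = j + 1) p
  have h2 := congrArg (fun φ : P.X j ⟶ K.X j => φ p)
    (Homotopy.nullHomotopicMap'_f (c := ComplexShape.up ℤ)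
      (show (ComplexShape.up ℤ).Rel (j - 1) j from sub_add_cancel j 1)
      (show (ComplexShape.up ℤ).Rel j (j + 1) from rfl)
      (fun i j _ => ModuleCat.ofHom (s i j)))
  have h3 : ∀ i j (p : P.X i), h.hom i j p = (S j).mkQ (s i j p) := fun i j p =>
    (LinearMap.congr_fun (hs i j) p).symm
  rw [← Submodule.Quotient.mk_eq_zero, ← Submodule.mkQ_apply]
  refine (map_sub (S j).mkQ _ _).trans (sub_eq_zero.2 ?_)
  refine (Eq.trans h1 ?_).trans (congrArg (S j).mkQ h2.symm)
  rw [h3, h3]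
  exact (map_add (S j).mkQ _ _).symm

end Subcomplexes

/-! ### Truncations -/

section Truncations

variable {R : Type u} [Ring R] (X : CochainComplex (ModuleCat.{u} R) ℤ) (c : ℤ)

/-- The terms of the truncation of `X` to the degrees at most `c`, with the cycles in
degree `c`. -/
def cyclesTruncation (i : ℤ) : Submodule R (X.X i) where
  carrier := {z | (c < i → z = 0) ∧ (c ≤ i → X.d i (i + 1) z = 0)}
  add_mem' := fun {z w} hz hw => ⟨fun h => by rw [hz.1 h, hw.1 h, add_zero],
    fun h => by rw [map_add, hz.2 h, hw.2 h, add_zero]⟩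
  zero_mem' := ⟨fun _ => rfl, fun _ => map_zero _⟩
  smul_mem' := fun r z hz => ⟨fun h => by rw [hz.1 h, smul_zero],
    fun h => by rw [map_smul, hz.2 h, smul_zero]⟩

/-- The terms of the truncation of `X` to the degrees at most `c`, with the boundaries in
degree `c`. -/
def boundariesTruncation (i : ℤ) : Submodule R (X.X i) where
  carrier := {z | (c < i → z = 0) ∧ (c ≤ i → ∀ l, l + 1 = i → ∃ w : X.X l, X.d l i w = z)}
  add_mem' := fun {z w} hz hw => ⟨fun h => by rw [hz.1 h, hw.1 h, add_zero],
    fun h l hl => by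
      obtain ⟨u, hu⟩ := hz.2 h l hl
      obtain ⟨v, hv⟩ := hw.2 h l hl
      exact ⟨u + v, by rw [map_add, hu, hv]⟩⟩
  zero_mem' := ⟨fun _ => rfl, fun _ _ _ => ⟨0, map_zero _⟩⟩
  smul_mem' := fun r z hz => ⟨fun h => by rw [hz.1 h, smul_zero],
    fun h l hl => by
      obtain ⟨u, hu⟩ := hz.2 h l hl
      exact ⟨r • u, by rw [map_smul, hu]⟩⟩

theorem d_mem_cyclesTruncation (i j : ℤ) (s : X.X i) (hs : s ∈ cyclesTruncation X c i) :
    X.d i j s ∈ cyclesTruncation X c j := by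
  by_cases hij : i + 1 = j
  · subst hij
    exact ⟨fun h => hs.2 (by lia), fun _ => d_d_apply X _ _ _ s⟩
  · rw [X.shape i j hij]
    exact (cyclesTruncation X c j).zero_mem

theorem d_mem_boundariesTruncation (i j : ℤ) (s : X.X i) (hs : s ∈ boundariesTruncation X c i) :
    X.d i j s ∈ boundariesTruncation X c j := by
  by_cases hij : i + 1 = j
  · subst hij
    refine ⟨fun h => ?_, fun _ l hl => ?_⟩
    · obtain ⟨w, rfl⟩ := hs.2 (by lia) (i - 1) (by lia)
      exact d_d_apply X _ _ _ w
    · obtain rfl : l = i := by lia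
      exact ⟨s, rfl⟩
  · rw [X.shape i j hij]
    exact (boundariesTruncation X c j).zero_mem

variable {X c}

theorem mem_boundariesTruncation_of_lt {j : ℤ} (hj : j < c) (w : X.X j) :
    w ∈ boundariesTruncation X c j :=
  ⟨fun h => absurd h hj.not_gt, fun h => absurd hj h.not_gt⟩

theorem acyclic_subcomplexQuotient_cyclesTruncation (hX : ∀ i, c < i → X.ExactAt i) :
    (subcomplexQuotient X _ (d_mem_cyclesTruncation X c)).Acyclic := fun j =>
  (exactAt_iff_forall _ (sub_add_cancel j 1) rfl).2 fun q hq => by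
    obtain ⟨z, rfl⟩ := (cyclesTruncation X c j).mkQ_surjective q
    have hz : X.d j (j + 1) z ∈ cyclesTruncation X c (j + 1) :=
      (Submodule.Quotient.mk_eq_zero _).1 hq
    by_cases hj : c < j
    · obtain ⟨w, hw⟩ := (exactAt_iff_forall X (sub_add_cancel j 1) rfl).1 (hX j hj) z
        (hz.1 (by lia))
      exact ⟨(cyclesTruncation X c (j - 1)).mkQ w, congrArg (cyclesTruncation X c j).mkQ hw⟩
    · have hz' : z ∈ cyclesTruncation X c j := ⟨fun h => absurd h hj, fun h => hz.1 (by lia)⟩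
      refine ⟨0, ?_⟩
      rw [map_zero]
      exact ((Submodule.Quotient.mk_eq_zero (cyclesTruncation X c j)).2 hz').symm

/-- In degrees at least `c` the truncation with boundaries in degree `c` consists of boundaries. -/
theorem exists_boundariesTruncation_d_eq {j : ℤ} (hj : c ≤ j) (z : boundariesTruncation X c j) :
    ∃ w : boundariesTruncation X c (j - 1), X.d (j - 1) j w.1 = z.1 := by
  obtain ⟨z, hz⟩ := z
  by_cases hjc : c < j
  · exact ⟨0, (map_zero _).trans (hz.1 hjc).symm⟩
  · obtain ⟨w, hw⟩ := hz.2 hj (j - 1) (sub_add_cancel j 1)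
    exact ⟨⟨w, mem_boundariesTruncation_of_lt (by lia) w⟩, hw⟩

end Truncations

/-! ### The ghost lemma -/

section Ghosts

variable {R : Type u} [CommRing R]

/-- Ghost lemma. Let `P` be a K-projective complex of projective modules, and let `X` be a complex
whose homology is killed by `x` and concentrated in `n` consecutive degrees. Every morphism `P ⟶ X`
becomes null-homotopic after multiplication by `x ^ n`.

Let `c` be the top degree of the homology of `X`. Up to homotopy the morphism takes values in the
truncation of `X` with the cycles in degree `c`. Multiplication by `x` maps it to the truncation
with the boundaries in degree `c`, which has one homology module fewer. -/
theorem nonempty_homotopy_pow_smul {P : CochainComplex (ModuleCat.{u} R) ℤ}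
    (hP : P.IsKProjective) (hproj : ∀ i, Module.Projective R (P.X i)) (x : R) (a : ℤ) (n : ℕ) :
    ∀ (X : CochainComplex (ModuleCat.{u} R) ℤ), (∀ i, (i < a ∨ a + n ≤ i) → X.ExactAt i) →
      (∀ i j k, i + 1 = j → j + 1 = k → ∀ z : X.X j, X.d j k z = 0 →
        ∃ w : X.X i, X.d i j w = x • z) →
      ∀ f : P ⟶ X, Nonempty (Homotopy (x ^ n • f) 0) := by
  induction n with
  | zero =>
    intro X hX _ f
    obtain ⟨h⟩ := hP.nonempty_homotopy_zero f (fun i => hX i (by simp; lia))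
    exact ⟨(Homotopy.ofEq (by simp)).trans h⟩
  | succ n ih =>
    intro X hX hx f
    set c : ℤ := a + n with hc
    have hXc : ∀ i, c < i → X.ExactAt i := fun i hi => hX i (Or.inr (by push_cast; lia))
    -- Up to the null-homotopic `ν`, the morphism `f` takes values in the truncation with cycles in
    -- degree `c`.
    obtain ⟨ν, ⟨hν⟩, hf'⟩ := exists_nullHomotopic_sub_mem _ (d_mem_cyclesTruncation X c) hP hproj
      (acyclic_subcomplexQuotient_cyclesTruncation hXc) f
    -- Multiplication by `x` carries cycles in degree `c` to boundaries.
    have hxZ : ∀ j, ∀ z ∈ cyclesTruncation X c j, x • z ∈ boundariesTruncation X c j :=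
      fun j z hz => ⟨fun hj => by rw [hz.1 hj, smul_zero],
        fun hj l hl => hx l j (j + 1) hl rfl z (hz.2 hj)⟩
    let g : P ⟶ subcomplex X _ (d_mem_boundariesTruncation X c) :=
      { f := fun j => ModuleCat.ofHom
          (LinearMap.codRestrict (boundariesTruncation X c j) (x • ((f - ν).f j).hom)
            fun p => hxZ j _ (hf' j p))
        comm' := fun i j _ => by
          apply ModuleCat.hom_ext
          apply LinearMap.ext
          intro p
          apply Subtype.ext
          change X.d i j (x • (f - ν).f i p) = x • (f - ν).f j (P.d i j p)
          rw [map_smul, hom_f_d_apply] }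
    have hg : g ≫ subcomplexι X _ (d_mem_boundariesTruncation X c) = x • (f - ν) := rfl
    obtain ⟨H⟩ := ih (subcomplex X _ (d_mem_boundariesTruncation X c))
      (fun j hj => (exactAt_iff_forall _ (sub_add_cancel j 1) rfl).2 fun z hz => by
        by_cases hjc : c ≤ j
        · obtain ⟨w, hw⟩ := exists_boundariesTruncation_d_eq hjc z
          exact ⟨w, Subtype.ext hw⟩
        · obtain ⟨w, hw⟩ := (exactAt_iff_forall X (sub_add_cancel j 1) rfl).1
            (hX j (Or.inl (by lia))) z.1 (congrArg Subtype.val hz)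
          exact ⟨⟨w, mem_boundariesTruncation_of_lt (by lia) w⟩, Subtype.ext hw⟩)
      (fun i j k hij hjk z hz => by
        obtain rfl : i = j - 1 := by lia
        by_cases hjc : c ≤ j
        · obtain ⟨w, hw⟩ := exists_boundariesTruncation_d_eq hjc z
          refine ⟨x • w, Subtype.ext ?_⟩
          change X.d (j - 1) j (x • w.1) = x • z.1
          rw [map_smul, hw]
        · obtain ⟨w, hw⟩ := hx (j - 1) j k hij hjk z.1 (congrArg Subtype.val hz)
          exact ⟨⟨w, mem_boundariesTruncation_of_lt (by lia) w⟩, Subtype.ext hw⟩) g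
    have H' := (H.compRight (subcomplexι X _ (d_mem_boundariesTruncation X c))).add
      (hν.smul (x ^ (n + 1)))
    refine ⟨(Homotopy.ofEq ?_).trans (H'.trans (Homotopy.ofEq ?_))⟩
    · rw [Linear.smul_comp, hg, smul_smul, ← pow_succ, ← smul_add, sub_add_cancel]
    · rw [zero_comp, smul_zero, add_zero]

end Ghosts

/-! ### Powers of weakly regular sequences -/

section RegularSequences

open RingTheory.Sequence
open scoped Pointwise

variable {R : Type u} [CommRing R]

/-- Weak regularity passes to extensions. -/
theorem isWeaklyRegular_of_exact (rs : List R) :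
    ∀ {M₁ M₂ M₃ : Type u} [AddCommGroup M₁] [AddCommGroup M₂] [AddCommGroup M₃]
      [Module R M₁] [Module R M₂] [Module R M₃] {f : M₁ →ₗ[R] M₂} {g : M₂ →ₗ[R] M₃},
      Function.Injective f → Function.Exact f g → Function.Surjective g →
      IsWeaklyRegular M₁ rs → IsWeaklyRegular M₃ rs → IsWeaklyRegular M₂ rs := by
  induction rs with
  | nil => intros; exact .nil _ _
  | cons r rs ih =>
    intro M₁ M₂ M₃ _ _ _ _ _ _ f g hf hfg hg h₁ h₃
    rw [isWeaklyRegular_cons_iff] at h₁ h₃ ⊢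
    refine ⟨isSMulRegular_of_range_eq_ker hf (LinearMap.exact_iff.1 hfg).symm h₁.1 h₃.1,
      ih (f := QuotSMulTop.map r f) (g := QuotSMulTop.map r g) ?_
        (QuotSMulTop.map_exact r hfg hg) (QuotSMulTop.map_surjective r hg) h₁.2 h₃.2⟩
    have h0 : Function.Exact (0 : M₁ →ₗ[R] M₁) f := by
      rw [LinearMap.exact_iff, LinearMap.ker_eq_bot.2 hf, LinearMap.range_zero]
    have := QuotSMulTop.map_first_exact_on_four_term_exact_of_isSMulRegular_last h0 hfg h₃.1
    rw [map_zero, LinearMap.exact_iff, LinearMap.range_zero] at this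
    exact LinearMap.ker_eq_bot.1 this

/-- The first term of a weakly regular sequence may be replaced by a power, by induction along the
extensions `0 → M / r ^ n → M / r ^ (n + 1) → M / r → 0`. -/
theorem isWeaklyRegular_quotSMulTop_pow {M : Type u} [AddCommGroup M] [Module R M] {r : R}
    (hr : IsSMulRegular M r) {rs : List R} (h : IsWeaklyRegular (QuotSMulTop r M) rs) (n : ℕ) :
    IsWeaklyRegular (QuotSMulTop (r ^ (n + 1)) M) rs := by
  induction n with
  | zero => rwa [zero_add, pow_one]
  | succ n ih =>
    have hle : r ^ (n + 1) • (⊤ : Submodule R M) ≤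
        (r ^ (n + 1 + 1) • (⊤ : Submodule R M)).comap (LinearMap.lsmul R M r) := by
      rintro _ ⟨v, -, rfl⟩
      refine ⟨v, trivial, ?_⟩
      change r ^ (n + 1 + 1) • v = r • r ^ (n + 1) • v
      rw [← mul_smul, ← pow_succ']
    have hle' : r ^ (n + 1 + 1) • (⊤ : Submodule R M) ≤ r • (⊤ : Submodule R M) := by
      rintro _ ⟨v, -, rfl⟩
      refine ⟨r ^ (n + 1) • v, trivial, ?_⟩
      change r • r ^ (n + 1) • v = r ^ (n + 1 + 1) • v
      rw [← mul_smul, ← pow_succ']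
    refine isWeaklyRegular_of_exact rs (f := Submodule.mapQ _ _ (LinearMap.lsmul R M r) hle)
      (g := Submodule.factor hle') ?_ ?_ (Submodule.factor_surjective hle') ih h
    · rw [injective_iff_map_eq_zero]
      intro c hc
      obtain ⟨m, rfl⟩ := Submodule.mkQ_surjective _ c
      obtain ⟨v, -, hv⟩ := (Submodule.Quotient.mk_eq_zero _).1 hc
      refine (Submodule.Quotient.mk_eq_zero _).2 ⟨v, trivial, hr ?_⟩
      simpa [pow_succ' r (n + 1), mul_smul] using hv
    · intro c
      obtain ⟨m, rfl⟩ := Submodule.mkQ_surjective _ c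
      constructor
      · intro hc
        obtain ⟨v, -, rfl⟩ := (Submodule.Quotient.mk_eq_zero _).1 hc
        exact ⟨Submodule.mkQ _ v, rfl⟩
      · rintro ⟨c', hc'⟩
        obtain ⟨v, rfl⟩ := Submodule.mkQ_surjective _ c'
        rw [← hc']
        exact (Submodule.Quotient.mk_eq_zero _).2 ⟨v, trivial, rfl⟩

theorem isWeaklyRegular_map_pow (n : ℕ) (rs : List R) :
    ∀ {M : Type u} [AddCommGroup M] [Module R M], IsWeaklyRegular M rs →
      IsWeaklyRegular M (rs.map (· ^ (n + 1))) := by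
  induction rs with
  | nil => intros; exact .nil _ _
  | cons r rs ih =>
    intro M _ _ h
    rw [isWeaklyRegular_cons_iff] at h
    rw [List.map_cons, isWeaklyRegular_cons_iff]
    exact ⟨h.1.pow (n + 1), isWeaklyRegular_quotSMulTop_pow h.1 (ih h.2) n⟩

theorem isWeaklyRegular_of_flat {rs : List R} (h : IsWeaklyRegular R rs) (M : Type u)
    [AddCommGroup M] [Module R M] [Module.Flat R M] : IsWeaklyRegular M rs :=
  ((TensorProduct.rid R M).isWeaklyRegular_congr rs).1 (h.isWeaklyRegular_lTensor (M₂ := M))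

end RegularSequences

/-! ### Extension of scalars of semi-projective complexes -/

section ExtensionOfScalars

open CochainComplex.HomComplex

section Adjunction

variable {C D : Type*} [Category.{u} C] [Category.{u} D] [Preadditive C] [Preadditive D]
  {F : C ⥤ D} {G : D ⥤ C} [F.Additive] [G.Additive] (adj : F ⊣ G) (P : CochainComplex C ℤ)
  (K : CochainComplex D ℤ)

/-- The adjunction isomorphism for cochains. -/
noncomputable def cochainAdj (n : ℤ) :
    Cochain ((F.mapHomologicalComplex (.up ℤ)).obj P) K n ≃+
      Cochain P ((G.mapHomologicalComplex (.up ℤ)).obj K) n where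
  toFun z := Cochain.mk fun p q hpq => adj.homEquiv (P.X p) (K.X q) (z.v p q hpq)
  invFun z := Cochain.mk fun p q hpq => (adj.homEquiv (P.X p) (K.X q)).symm (z.v p q hpq)
  left_inv z := by
    ext p q hpq
    exact (adj.homEquiv _ _).symm_apply_apply _
  right_inv z := by
    ext p q hpq
    exact (adj.homEquiv _ _).apply_symm_apply _
  map_add' z w := by
    ext p q hpq
    exact map_add (adj.homAddEquiv (P.X p) (K.X q)) (z.v p q hpq) (w.v p q hpq)

theorem cochainAdj_v (n : ℤ) (z : Cochain ((F.mapHomologicalComplex (.up ℤ)).obj P) K n)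
    (p q : ℤ) (hpq : p + n = q) :
    (cochainAdj adj P K n z).v p q hpq = adj.homAddEquiv (P.X p) (K.X q) (z.v p q hpq) :=
  rfl

theorem δ_cochainAdj (n m : ℤ) (hnm : n + 1 = m)
    (z : Cochain ((F.mapHomologicalComplex (.up ℤ)).obj P) K n) :
    δ n m (cochainAdj adj P K n z) = cochainAdj adj P K m (δ n m z) := by
  ext p q hpq
  have key : ∀ (X Y : C) (U V : D) (d : X ⟶ Y) (d' : U ⟶ V) (ε : ℤˣ) (φ : F.obj X ⟶ U)
      (ψ : F.obj Y ⟶ V), adj.homAddEquiv X V (φ ≫ d' + ε • F.map d ≫ ψ) =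
        adj.homAddEquiv X U φ ≫ G.map d' + ε • d ≫ adj.homAddEquiv Y V ψ := by
    intro X Y U V d d' ε φ ψ
    rw [map_add, Units.smul_def, Units.smul_def, map_zsmul]
    congr 2
    · exact adj.homEquiv_naturality_right _ _
    · exact adj.homEquiv_naturality_left _ _
  refine (δ_v n m hnm _ p q hpq (q - 1) (p + 1) rfl rfl).trans (Eq.trans ?_
    (congrArg (adj.homAddEquiv (P.X p) (K.X q))
      (δ_v n m hnm _ p q hpq (q - 1) (p + 1) rfl rfl)).symm)
  exact (key _ _ _ _ _ _ _ _ _).symm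

theorem cochainAdj_comp_ofHom {K L : CochainComplex D ℤ} (β : K ⟶ L) (n : ℤ)
    (z : Cochain ((F.mapHomologicalComplex (.up ℤ)).obj P) K n) :
    cochainAdj adj P L n (z.comp (Cochain.ofHom β) (add_zero n)) =
      (cochainAdj adj P K n z).comp
        (Cochain.ofHom ((G.mapHomologicalComplex (.up ℤ)).map β)) (add_zero n) := by
  ext p q hpq
  rw [cochainAdj_v]
  refine (congrArg _ (Cochain.comp_zero_cochain_v _ _ _ _ _)).trans (Eq.trans ?_
    (Cochain.comp_zero_cochain_v _ _ _ _ _).symm)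
  rw [Cochain.ofHom_v, Cochain.ofHom_v]
  exact adj.homEquiv_naturality_right _ _

/-- The adjunction isomorphism of Hom complexes. -/
noncomputable def homComplexAdj :
    CochainComplex.HomComplex ((F.mapHomologicalComplex (.up ℤ)).obj P) K ≅
      CochainComplex.HomComplex P ((G.mapHomologicalComplex (.up ℤ)).obj K) :=
  HomologicalComplex.Hom.isoOfComponents
    (fun n => (cochainAdj adj P K n).toAddCommGrpIso)
    (fun i j hij => by
      ext z
      exact δ_cochainAdj adj P K i j hij z)

end Adjunction

variable {A B : Type u} [CommRing A] [CommRing B] (f : A →+* B)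

instance : (ModuleCat.extendScalars.{u, u, u} f).Additive :=
  (ModuleCat.extendRestrictScalarsAdj.{u} f).left_adjoint_additive

/-- Extension of scalars of complexes of modules along a ring homomorphism. -/
noncomputable def extendComplex (P : CochainComplex (ModuleCat.{u} A) ℤ) :
    CochainComplex (ModuleCat.{u} B) ℤ :=
  ((ModuleCat.extendScalars f).mapHomologicalComplex (ComplexShape.up ℤ)).obj P

theorem IsSemiProjective.extendComplex {P : CochainComplex (ModuleCat.{u} A) ℤ}
    (hP : IsSemiProjective P) : IsSemiProjective (extendComplex f P) := by
  intro K L β hβ hq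
  let G := (ModuleCat.restrictScalars.{u} f).mapHomologicalComplex (ComplexShape.up ℤ)
  have hGq : QuasiIso (G.map β) := inferInstance
  obtain ⟨h1, h2⟩ := hP (G.map β) hβ hGq
  let adj := ModuleCat.extendRestrictScalarsAdj.{u} f
  have hnat : homComplexMap (QuasiProjective.extendComplex f P) β ≫ (homComplexAdj adj P L).hom =
      (homComplexAdj adj P K).hom ≫ homComplexMap P (G.map β) := by
    ext n z
    exact cochainAdj_comp_ofHom adj P β n z
  refine ⟨fun n z => ?_, ?_⟩
  · obtain ⟨w, hw⟩ := h1 n (cochainAdj adj P L n z)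
    obtain ⟨u, rfl⟩ := (cochainAdj adj P K n).surjective w
    exact ⟨u, (cochainAdj adj P L n).injective ((cochainAdj_comp_ofHom adj P β n u).trans hw)⟩
  · have hK : QuasiIso (homComplexAdj adj P K).hom := inferInstance
    have hL : QuasiIso (homComplexAdj adj P L).hom := inferInstance
    have h3 := @quasiIso_comp _ _ _ _ _ _ _ _ (homComplexAdj adj P K).hom
      (homComplexMap P (G.map β)) inferInstance inferInstance inferInstance hK h2
    rw [← hnat] at h3
    exact @quasiIso_of_comp_right _ _ _ _ _ _ _ _ _ (homComplexAdj adj P L).hom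
      inferInstance inferInstance inferInstance hL h3

end ExtensionOfScalars

/-! ### Restriction of scalars and the unit of extension -/

section RestrictionOfScalars

variable {A B : Type u} [CommRing A] [CommRing B]

theorem nonempty_homology_restrictComplex_equiv (f : A →+* B)
    (K : CochainComplex (ModuleCat.{u} B) ℤ) (k : ℤ) :
    Nonempty ((restrictComplex f K).homology k ≃ₗ[A]
      (ModuleCat.restrictScalars f).obj (K.homology k)) :=
  ⟨((K.sc k).mapHomologyIso (ModuleCat.restrictScalars.{u} f)).toLinearEquiv⟩

theorem isZero_homology_restrictComplex_iff (f : A →+* B)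
    (K : CochainComplex (ModuleCat.{u} B) ℤ) (k : ℤ) :
    IsZero ((restrictComplex f K).homology k) ↔ IsZero (K.homology k) := by
  obtain ⟨e⟩ := nonempty_homology_restrictComplex_equiv f K k
  rw [ModuleCat.isZero_iff_subsingleton, ModuleCat.isZero_iff_subsingleton]
  exact e.toEquiv.subsingleton_congr

theorem acyclic_restrictComplex_iff (f : A →+* B)
    (K : CochainComplex (ModuleCat.{u} B) ℤ) : (restrictComplex f K).Acyclic ↔ K.Acyclic := by
  simp_rw [acyclic_iff_forall_isZero_homology, isZero_homology_restrictComplex_iff]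

/-- Along a surjective ring homomorphism, linearity after restriction of scalars is linearity. -/
noncomputable def linearEquivOfRestrictScalars (f : A →+* B) (hf : Function.Surjective f)
    {X : ModuleCat.{u} B} {J : Type} {N : J → ModuleCat.{u} B}
    (e : (ModuleCat.restrictScalars f).obj X ≃ₗ[A]
      ∀ j, (ModuleCat.restrictScalars f).obj (N j)) : X ≃ₗ[B] ∀ j, N j :=
  { e.toAddEquiv with
    map_smul' := fun b x => by
      obtain ⟨a, rfl⟩ := hf b
      exact e.map_smul a x }

variable (f : A →+* B)

/-- The unit `P ⟶ B ⊗ P` of extension of scalars. -/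
noncomputable def extendComplexUnit (P : CochainComplex (ModuleCat.{u} A) ℤ) :
    P ⟶ restrictComplex f (extendComplex f P) where
  f i := (ModuleCat.extendRestrictScalarsAdj.{u} f).unit.app (P.X i)
  comm' i j _ := ((ModuleCat.extendRestrictScalarsAdj.{u} f).unit.naturality (P.d i j)).symm

open scoped TensorProduct in
theorem extendComplexUnit_surjective (hf : Function.Surjective f)
    (P : CochainComplex (ModuleCat.{u} A) ℤ) (i : ℤ) :
    Function.Surjective ((extendComplexUnit f P).f i) := by
  let _ : Algebra A B := f.toAlgebra
  intro t
  change B ⊗[A] P.X i at t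
  change ∃ p : P.X i, (1 : B) ⊗ₜ[A] p = t
  induction t with
  | zero => exact ⟨0, TensorProduct.tmul_zero _ _⟩
  | tmul b p =>
    obtain ⟨a, rfl⟩ := hf b
    refine ⟨a • p, ?_⟩
    rw [← TensorProduct.smul_tmul]
    congr 1
    exact mul_one (f a)
  | add t₁ t₂ h₁ h₂ =>
    obtain ⟨p₁, rfl⟩ := h₁
    obtain ⟨p₂, rfl⟩ := h₂
    exact ⟨p₁ + p₂, TensorProduct.tmul_add _ _ _⟩

theorem extendComplexUnit_eq_zero_iff (I : Ideal A) (P : CochainComplex (ModuleCat.{u} A) ℤ)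
    (i : ℤ) (p : P.X i) : (extendComplexUnit (Ideal.Quotient.mk I) P).f i p = 0 ↔
      p ∈ I • (⊤ : Submodule A (P.X i)) := by
  let adj := ModuleCat.extendRestrictScalarsAdj.{u} (Ideal.Quotient.mk I)
  constructor
  · intro hp
    -- The projection `P.X i → P.X i / I P.X i` factors through the unit.
    let Y : ModuleCat.{u} (A ⧸ I) :=
      ModuleCat.of (A ⧸ I) (P.X i ⧸ I • (⊤ : Submodule A (P.X i)))
    let g : P.X i ⟶ (ModuleCat.restrictScalars (Ideal.Quotient.mk I)).obj Y :=
      ModuleCat.ofHom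
        { toFun := (I • (⊤ : Submodule A (P.X i))).mkQ
          map_add' := map_add _
          map_smul' := fun a q => map_smul (I • (⊤ : Submodule A (P.X i))).mkQ a q }
    have hg : adj.unit.app (P.X i) ≫ (ModuleCat.restrictScalars (Ideal.Quotient.mk I)).map
        ((adj.homEquiv _ _).symm g) = g := by
      exact (adj.homEquiv_unit _ _ _).symm.trans ((adj.homEquiv _ _).apply_symm_apply g)
    have h1 : g p = 0 := by
      rw [← hg, ConcreteCategory.comp_apply]
      exact (congrArg _ hp).trans (map_zero _)
    exact (Submodule.Quotient.mk_eq_zero _).1 h1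
  · intro hp
    refine Submodule.smul_induction_on hp (fun a ha q _ => ?_) (fun q q' hq hq' => ?_)
    · rw [map_smul]
      have h0 : ∀ t : (extendComplex (Ideal.Quotient.mk I) P).X i,
          Ideal.Quotient.mk I a • t = 0 := fun t => by
        rw [Ideal.Quotient.eq_zero_iff_mem.2 ha, zero_smul]
      exact h0 _
    · rw [map_add, hq, hq', add_zero]

theorem restrictComplex_quotient_factor {R : Type u} [CommRing R] {I J : Ideal R} (h : I ≤ J)
    (M : CochainComplex (ModuleCat.{u} (R ⧸ J)) ℤ) :
    restrictComplex (Ideal.Quotient.mk J) M =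
      restrictComplex (Ideal.Quotient.mk I) (restrictComplex (Ideal.Quotient.factor h) M) :=
  rfl

end RestrictionOfScalars

/-! ### Quasi-projective resolutions and finite products of shifts -/

section FiniteShifts

variable {R : Type u} [Ring R]

/-- A direct sum of finite powers with finitely many factors in total is a finite product. -/
theorem nonempty_directSum_equiv_pi {ι : Type*} [DecidableEq ι] (a : ι → ℕ)
    [Finite (Σ i, Fin (a i))] (V : ι → Type*) [∀ i, AddCommGroup (V i)] [∀ i, Module R (V i)] :
    Nonempty (DirectSum ι (fun i => Fin (a i) → V i) ≃ₗ[R] ∀ p : Σ i, Fin (a i), V p.1) := by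
  classical
  have := Fintype.ofFinite (Σ i, Fin (a i))
  let φ : DirectSum ι (fun i => Fin (a i) → V i) →ₗ[R] ∀ p : Σ i, Fin (a i), V p.1 :=
    { toFun := fun v p => v p.1 p.2
      map_add' := fun _ _ => rfl
      map_smul' := fun _ _ => rfl }
  refine ⟨LinearEquiv.ofBijective φ ⟨fun v w h => ?_, fun g => ?_⟩⟩
  · refine DFinsupp.ext fun i => funext fun c => congrFun h ⟨i, c⟩
  · let s : Finset ι := Finset.univ.image (Sigma.fst : (Σ i, Fin (a i)) → ι)
    refine ⟨DFinsupp.mk s fun i c => g ⟨i, c⟩, funext fun ⟨i, c⟩ => ?_⟩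
    have hi : i ∈ s := Finset.mem_image.2 ⟨⟨i, c⟩, Finset.mem_univ _, rfl⟩
    have hmk := DFinsupp.mk_of_mem (β := fun i => Fin (a i) → V i) (s := s)
      (x := fun i c => g ⟨i, c⟩) hi
    exact congrFun hmk c

/-- Only finitely many shifts of `M` occur in a bounded above quasi-projective resolution, because
each shift carries a fixed nonzero homology module of `M` along. -/
theorem IsQuasiProjectiveResolution.exists_finite_shifts
    {P M : CochainComplex (ModuleCat.{u} R) ℤ} (h : IsQuasiProjectiveResolution P M)
    (hP : IsBoundedAbove P) (hM : ¬ M.Acyclic) :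
    ∃ (J : Type) (_ : Fintype J) (_ : Nonempty J) (e : J → ℤ),
      ∀ k, Nonempty (P.homology k ≃ₗ[R] ∀ j, M.homology (k + e j)) := by
  obtain ⟨-, ℓ, a, ⟨i₀, hi₀, ha₀⟩, he⟩ := h
  obtain ⟨s, hs⟩ := hP
  rw [acyclic_iff_forall_isZero_homology] at hM
  push Not at hM
  obtain ⟨m, hm⟩ := hM
  rw [ModuleCat.isZero_iff_subsingleton, not_subsingleton_iff_nontrivial] at hm
  have hbound : ∀ i, ℓ ≤ i → a i ≠ 0 → i ≤ s + m := by
    intro i hi hai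
    by_contra hlt
    have hz := isZero_homology_of_isZero P (hs (i - m) (by lia))
    rw [ModuleCat.isZero_iff_subsingleton] at hz
    obtain ⟨e⟩ := he (-(i - m))
    obtain ⟨y, hy⟩ := exists_ne (0 : M.homology m)
    have : Subsingleton (DirectSum {i : ℤ // ℓ ≤ i}
      fun i' => (Fin (a i') → M.homology (-(i - m) + i'))) := e.symm.toEquiv.subsingleton
    have h1 : Subsingleton (Fin (a i) → M.homology (-(i - m) + i)) :=
      (DirectSum.of_injective (β := fun i' : {i : ℤ // ℓ ≤ i} =>
        (Fin (a i') → M.homology (-(i - m) + i'))) ⟨i, hi⟩).subsingleton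
    rw [show -(i - m) + i = m by ring] at h1
    have h2 := congrFun (h1.elim (fun _ => y) 0) ⟨0, Nat.pos_of_ne_zero hai⟩
    exact hy h2
  let J := Σ i : {i : ℤ // ℓ ≤ i}, Fin (a i)
  have hJ : Finite J := by
    have : Finite (Σ i : Set.Icc ℓ (s + m), Fin (a i)) := inferInstance
    refine Finite.of_injective (β := Σ i : Set.Icc ℓ (s + m), Fin (a i))
      (fun p => ⟨⟨p.1, p.1.2, hbound _ p.1.2 (Fin.pos p.2).ne'⟩, p.2⟩) ?_
    rintro ⟨⟨i, hi⟩, c⟩ ⟨⟨i', hi'⟩, c'⟩ h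
    obtain rfl : i = i' := congrArg (fun p => (p.1 : ℤ)) h
    obtain rfl : c = c' := by simpa using h
    rfl
  refine ⟨J, Fintype.ofFinite J, ⟨⟨⟨i₀, hi₀⟩, ⟨0, Nat.pos_of_ne_zero ha₀⟩⟩⟩, fun p => p.1,
    fun k => ?_⟩
  obtain ⟨e⟩ := he k
  obtain ⟨e'⟩ := nonempty_directSum_equiv_pi (R := R) (fun i : {i : ℤ // ℓ ≤ i} => a i)
    (fun i => M.homology (k + i))
  exact ⟨e ≪≫ₗ e'⟩

theorem isQuasiProjectiveResolution_of_finite_shifts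
    {P M : CochainComplex (ModuleCat.{u} R) ℤ} (hP : IsSemiProjective P)
    {J : Type} [Finite J] [Nonempty J] (e : J → ℤ)
    (he : ∀ k, Nonempty (P.homology k ≃ₗ[R] ∀ j, M.homology (k + e j))) :
    IsQuasiProjectiveResolution P M := by
  classical
  have := Fintype.ofFinite J
  obtain ⟨ℓ, hℓ⟩ := (Set.finite_range e).bddBelow
  have hℓ' : ∀ j, ℓ ≤ e j := fun j => hℓ ⟨j, rfl⟩
  -- The multiplicity of the shift by `i` is the number of `j` with `e j = i`.
  let a : ℤ → ℕ := fun i => Fintype.card {j // e j = i}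
  let ε : (Σ i : {i : ℤ // ℓ ≤ i}, Fin (a i)) ≃ J :=
    (Equiv.sigmaCongrRight fun i : {i : ℤ // ℓ ≤ i} =>
      (Fintype.equivFin {j // e j = i.1}).symm).trans
      { toFun := fun p => p.2.1
        invFun := fun j => ⟨⟨e j, hℓ' j⟩, ⟨j, rfl⟩⟩
        left_inv := by
          rintro ⟨⟨i, hi⟩, ⟨j, hj⟩⟩
          obtain rfl : e j = i := hj
          rfl
        right_inv := fun j => rfl }
  have hε : ∀ p, e (ε p) = p.1 := fun p => ((Fintype.equivFin {j // e j = p.1.1}).symm p.2).2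
  have : Finite (Σ i : {i : ℤ // ℓ ≤ i}, Fin (a i)) := Finite.of_equiv J ε.symm
  obtain ⟨j₀⟩ := ‹Nonempty J›
  refine ⟨hP, ℓ, a, ⟨e j₀, hℓ' j₀, ?_⟩, fun k => ?_⟩
  · exact (Fintype.card_pos_iff.2 ⟨⟨j₀, rfl⟩⟩).ne'
  · obtain ⟨e₁⟩ := he k
    obtain ⟨e₂⟩ := nonempty_directSum_equiv_pi (R := R) (fun i : {i : ℤ // ℓ ≤ i} => a i)
      (fun i => M.homology (k + i))
    let e₃ : ∀ p : Σ i : {i : ℤ // ℓ ≤ i}, Fin (a i),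
        M.homology (k + p.1) ≃ₗ[R] M.homology (k + e (ε p)) := fun p =>
      (eqToIso (by rw [hε])).toLinearEquiv
    exact ⟨e₁ ≪≫ₗ (LinearEquiv.piCongrLeft R (fun j => M.homology (k + e j)) ε).symm ≪≫ₗ
      (LinearEquiv.piCongrRight e₃).symm ≪≫ₗ e₂.symm⟩

end FiniteShifts

/-! ### Suprema of degrees and the infimum defining the dimension -/

section Degrees

theorem exists_sSup_intCast_eq {T : ℤ → Prop} {s : ℤ} (hs : ∀ i, T i → i ≤ s) (hT : ∃ i, T i) :
    ∃ m : ℤ, T m ∧ sSup {e : EReal | ∃ i : ℤ, T i ∧ e = ((i : ℝ) : EReal)} = ((m : ℝ) : EReal) := by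
  obtain ⟨m, hm, hmax⟩ := Int.exists_greatest_of_bdd ⟨s, hs⟩ hT
  refine ⟨m, hm, le_antisymm (sSup_le ?_) (le_sSup ⟨m, hm, rfl⟩)⟩
  rintro _ ⟨i, hi, rfl⟩
  exact_mod_cast hmax i hi

variable {R : Type u} [Ring R]

theorem exists_supDegree_eq {P : CochainComplex (ModuleCat.{u} R) ℤ} (hP : IsBoundedAbove P)
    (hne : ¬ P.Acyclic) : ∃ s h : ℤ, h ≤ s ∧ supDegree P = ((s : ℝ) : EReal) ∧
      hsupDegree P = ((h : ℝ) : EReal) ∧ ¬ IsZero (P.homology (-h)) := by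
  obtain ⟨b, hb⟩ := hP
  rw [acyclic_iff_forall_isZero_homology] at hne
  push Not at hne
  obtain ⟨k, hk⟩ := hne
  have hX : ∀ i : ℤ, ¬ IsZero (P.homology (-i)) → ¬ IsZero (P.X (-i)) := fun i hi hz =>
    hi (isZero_homology_of_isZero P hz)
  have hbX : ∀ i : ℤ, ¬ IsZero (P.X (-i)) → i ≤ b := fun i hi => by
    by_contra hlt
    exact hi (hb i (not_le.1 hlt))
  have hk' : ¬ IsZero (P.homology (-(-k))) := by rwa [neg_neg]
  obtain ⟨s, hs, hs'⟩ := exists_sSup_intCast_eq hbX ⟨-k, hX _ hk'⟩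
  obtain ⟨h, hh, hh'⟩ := exists_sSup_intCast_eq (fun i hi => hbX i (hX i hi)) ⟨-k, hk'⟩
  refine ⟨s, h, ?_, hs', hh', hh⟩
  have h1 : ((h : ℝ) : EReal) ≤ supDegree P := le_sSup ⟨h, hX h hh, rfl⟩
  have h2 : supDegree P = ((s : ℝ) : EReal) := hs'
  rw [h2] at h1
  exact_mod_cast h1

theorem IsQuasiProjectiveResolution.not_acyclic {P M : CochainComplex (ModuleCat.{u} R) ℤ}
    (h : IsQuasiProjectiveResolution P M) (hP : IsBoundedAbove P) (hM : ¬ M.Acyclic) :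
    ¬ P.Acyclic := by
  obtain ⟨J, _, ⟨j⟩, e, he⟩ := h.exists_finite_shifts hP hM
  rw [acyclic_iff_forall_isZero_homology] at hM ⊢
  contrapose! hM
  intro m
  obtain ⟨φ⟩ := he (m - e j)
  have h0 := hM (m - e j)
  rw [ModuleCat.isZero_iff_subsingleton] at h0 ⊢
  have h1 : Subsingleton (∀ j', M.homology (m - e j + e j')) := φ.symm.toEquiv.subsingleton
  have h2 : Subsingleton (M.homology (m - e j + e j)) :=
    (Function.surjective_eval (β := fun j' => M.homology (m - e j + e j')) j).subsingleton
  rwa [sub_add_cancel] at h2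

/-- A finite quasi-projective dimension is attained, as the values are natural numbers. -/
theorem qpd_eq_top_or_exists {M : CochainComplex (ModuleCat.{u} R) ℤ} (hM : ¬ M.Acyclic) :
    qpd M = ⊤ ∨ ∃ P, IsQuasiProjectiveResolution P M ∧ IsBoundedAbove P ∧
      qpd M = supDegree P - hsupDegree P := by
  rw [qpd, if_neg hM]
  by_cases hex : ∃ n : ℕ, ∃ P, IsQuasiProjectiveResolution P M ∧ IsBoundedAbove P ∧
      supDegree P - hsupDegree P = ((n : ℝ) : EReal)
  · classical
    right
    obtain ⟨P, hP, hPb, hPe⟩ := Nat.find_spec hex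
    refine ⟨P, hP, hPb, le_antisymm (sInf_le ⟨P, hP, hPb, rfl⟩) (le_sInf ?_)⟩
    rintro _ ⟨Q, hQ, hQb, rfl⟩
    obtain ⟨s, h, hle, hs, hh, -⟩ := exists_supDegree_eq hQb (hQ.not_acyclic hQb hM)
    obtain ⟨n, hn⟩ := Int.eq_ofNat_of_zero_le (sub_nonneg.2 hle)
    have hn' : supDegree Q - hsupDegree Q = ((n : ℝ) : EReal) := by
      rw [hs, hh, ← EReal.coe_sub]
      congr 1
      exact_mod_cast hn
    rw [hPe, hn']
    exact_mod_cast Nat.find_min' hex ⟨Q, hQ, hQb, hn'⟩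
  · left
    rw [sInf_eq_top]
    rintro _ ⟨Q, hQ, hQb, rfl⟩
    obtain ⟨s, h, hle, hs, hh, -⟩ := exists_supDegree_eq hQb (hQ.not_acyclic hQb hM)
    obtain ⟨n, hn⟩ := Int.eq_ofNat_of_zero_le (sub_nonneg.2 hle)
    refine absurd ⟨n, Q, hQ, hQb, ?_⟩ hex
    rw [hs, hh, ← EReal.coe_sub]
    congr 1
    exact_mod_cast hn

end Degrees

/-! ### Reduction of a semi-projective complex modulo powers -/

section Reduction

variable {R : Type u} [CommRing R]

/-- If `x` kills the bounded homology of a semi-projective complex `P`, then all high powers of `x`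
act null-homotopically on `P`. -/
theorem IsSemiProjective.exists_homotopy_pow_smul {P : CochainComplex (ModuleCat.{u} R) ℤ}
    (hP : IsSemiProjective P) {a b : ℤ} (hPa : ∀ k, k < a → IsZero (P.homology k))
    (hPb : ∀ k, b ≤ k → IsZero (P.homology k)) :
    ∃ w : ℕ, ∀ x : R, (∀ k (c : P.homology k), x • c = 0) →
      ∀ n, w ≤ n → Nonempty (Homotopy (x ^ n • 𝟙 P) 0) := by
  refine ⟨(b - a).toNat, fun x hx n hn => ?_⟩
  obtain ⟨h⟩ := nonempty_homotopy_pow_smul hP.isKProjective hP.projective x a (b - a).toNat P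
    (fun i hi => (HomologicalComplex.exactAt_iff_isZero_homology _ _).2
      (hi.elim (hPa i) fun h => hPb i (by lia)))
    (fun i j k hij hjk z hz => by
      obtain ⟨κ, -, hκ⟩ := exists_cycles_presentation P hij hjk
      have : κ (x • ⟨z, hz⟩) = 0 := by rw [map_smul, hx]
      exact (hκ _).1 this) (𝟙 P)
  refine ⟨(Homotopy.ofEq ?_).trans ((h.smul (x ^ (n - (b - a).toNat))).trans (Homotopy.ofEq ?_))⟩
  · rw [smul_smul, ← pow_add, Nat.sub_add_cancel hn]
  · rw [smul_zero]

variable {d : ℕ}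

theorem ofList_ofFn_pow (x : Fin d → R) (n : ℕ) :
    Ideal.ofList ((List.ofFn x).map (· ^ n)) = seqIdeal (fun i => x i ^ n) := by
  unfold Ideal.ofList seqIdeal
  congr 1
  ext r
  simp

/-- If high powers of `x_1, …, x_d` act null-homotopically on the semi-projective complex `P`, then
the homology of `R / (x_1 ^ n, …, x_d ^ n) ⊗ P` is a finite product of shifts of the homology of
`P`, one of them by `d`. -/
theorem exists_homology_extendComplex_equiv (x : Fin d → R)
    (hx : RingTheory.Sequence.IsWeaklyRegular R (List.ofFn x))
    {P : CochainComplex (ModuleCat.{u} R) ℤ} (hP : IsSemiProjective P) {n : ℕ} (hn : 1 ≤ n)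
    (hnull : ∀ i, Nonempty (Homotopy (x i ^ n • 𝟙 P) 0)) :
    ∃ (J : Type) (_ : Fintype J) (e : J → ℤ), (∃ j, e j = d) ∧
      ∀ k, Nonempty ((restrictComplex (Ideal.Quotient.mk (seqIdeal fun i => x i ^ n))
        (extendComplex (Ideal.Quotient.mk (seqIdeal fun i => x i ^ n)) P)).homology k ≃ₗ[R]
          ∀ j : J, P.homology (k + e j)) := by
  have hreg : RingTheory.Sequence.IsWeaklyRegular R ((List.ofFn x).map (· ^ n)) := by
    have := isWeaklyRegular_map_pow (n - 1) _ hx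
    rwa [Nat.sub_add_cancel hn] at this
  obtain ⟨J, hJ, e, ⟨j, hj⟩, he⟩ := exists_homology_quotient_equiv
    ((List.ofFn x).map (· ^ n))
    (extendComplexUnit (Ideal.Quotient.mk (seqIdeal fun i => x i ^ n)) P)
    (fun i => by
      have := hP.projective i
      exact isWeaklyRegular_of_flat hreg (P.X i))
    (fun r hr => by
      obtain ⟨i, rfl⟩ : ∃ i, x i ^ n = r := by simpa using hr
      exact hnull i)
    (extendComplexUnit_surjective _ Ideal.Quotient.mk_surjective P)
    (fun i p => by rw [ofList_ofFn_pow, extendComplexUnit_eq_zero_iff])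
  exact ⟨J, hJ, e, ⟨j, by simpa using hj⟩, he⟩

/-- A semi-projective complex whose homology is built from finitely many shifts of a bounded graded
module over `R / I` has a null-homotopic action of high powers of the elements of `I`. -/
theorem IsQuasiProjectiveResolution.exists_homotopy_pow_smul {I : Ideal R}
    {M : CochainComplex (ModuleCat.{u} (R ⧸ I)) ℤ} {P : CochainComplex (ModuleCat.{u} R) ℤ}
    (hP : IsQuasiProjectiveResolution P (restrictComplex (Ideal.Quotient.mk I) M))
    (hPb : IsBoundedAbove P) (hM : ¬ M.Acyclic) (hMb : HasBoundedHomology M) :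
    ∃ w : ℕ, ∀ x ∈ I, ∀ n, w ≤ n → Nonempty (Homotopy (x ^ n • 𝟙 P) 0) := by
  obtain ⟨J, _, _, e, he⟩ :=
    hP.exists_finite_shifts hPb (mt (acyclic_restrictComplex_iff _ M).1 hM)
  obtain ⟨b, hb⟩ := hPb
  obtain ⟨s, hs⟩ := hMb
  obtain ⟨ℓ, hℓ⟩ := (Set.finite_range e).bddBelow
  obtain ⟨w, hw⟩ := hP.1.exists_homotopy_pow_smul (a := -b) (b := |s| + 1 - ℓ)
    (fun k hk => by
      have := hb (-k) (by lia)
      rw [neg_neg] at this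
      exact isZero_homology_of_isZero P this)
    (fun k hk => by
      obtain ⟨φ⟩ := he k
      have h1 : ∀ j, Subsingleton ((restrictComplex (Ideal.Quotient.mk I) M).homology
          (k + e j)) := fun j => by
        rw [← ModuleCat.isZero_iff_subsingleton, isZero_homology_restrictComplex_iff]
        have h2 : ℓ ≤ e j := hℓ ⟨j, rfl⟩
        exact hs _ (lt_of_lt_of_le (by have := le_abs_self s; lia) (le_abs_self _))
      rw [ModuleCat.isZero_iff_subsingleton]
      exact φ.toEquiv.subsingleton)
  refine ⟨w, fun x hx => hw x fun k c => ?_⟩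
  obtain ⟨φ⟩ := he k
  apply φ.injective
  rw [map_smul, map_zero]
  funext j
  obtain ⟨ψ⟩ := nonempty_homology_restrictComplex_equiv (Ideal.Quotient.mk I) M (k + e j)
  apply ψ.injective
  rw [Pi.smul_apply, map_smul, Pi.zero_apply, map_zero]
  have h0 : ∀ t : M.homology (k + e j), Ideal.Quotient.mk I x • t = 0 := fun t => by
    rw [Ideal.Quotient.eq_zero_iff_mem.2 hx, zero_smul]
  exact h0 _

end Reduction

/-! ### Comparison of quasi-projective dimensions -/

section Comparison

variable {A B : Type u} [CommRing A] [CommRing B] {f : A →+* B}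

/-- Suppose that the homology of `B ⊗ P` is a finite product of shifts of the homology of `P`. If
`P` resolves the restriction of `M` to `A`, then `B ⊗ P` resolves `M`. -/
theorem IsQuasiProjectiveResolution.extendComplex (hf : Function.Surjective f)
    {M : CochainComplex (ModuleCat.{u} B) ℤ} {P : CochainComplex (ModuleCat.{u} A) ℤ}
    (hP : IsQuasiProjectiveResolution P (restrictComplex f M)) (hPb : IsBoundedAbove P)
    (hM : ¬ M.Acyclic) {J' : Type} [Finite J'] [Nonempty J'] (e' : J' → ℤ)
    (he' : ∀ k, Nonempty ((restrictComplex f (extendComplex f P)).homology k ≃ₗ[A]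
      ∀ j, P.homology (k + e' j))) :
    IsQuasiProjectiveResolution (extendComplex f P) M := by
  obtain ⟨J, _, _, e, he⟩ :=
    hP.exists_finite_shifts hPb (mt (acyclic_restrictComplex_iff _ M).1 hM)
  have : Nonempty (Σ _ : J', J) :=
    ⟨⟨Classical.arbitrary J', Classical.arbitrary J⟩⟩
  refine isQuasiProjectiveResolution_of_finite_shifts (hP.1.extendComplex f)
    (J := Σ _ : J', J) (fun p => e' p.1 + e p.2) fun k => ?_
  obtain ⟨φ⟩ := nonempty_homology_restrictComplex_equiv f (QuasiProjective.extendComplex f P) k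
  obtain ⟨φ'⟩ := he' k
  have ψ := fun j₁ : J' => (he (k + e' j₁)).some
  have χ : ∀ p : (Σ _ : J', J), (restrictComplex f M).homology (k + e' p.1 + e p.2) ≃ₗ[A]
      (ModuleCat.restrictScalars f).obj (M.homology (k + (e' p.1 + e p.2))) := fun p =>
    (eqToIso (by rw [add_assoc])).toLinearEquiv ≪≫ₗ
      (nonempty_homology_restrictComplex_equiv f M (k + (e' p.1 + e p.2))).some
  exact ⟨linearEquivOfRestrictScalars f hf
    (N := fun p : (Σ _ : J', J) => M.homology (k + (e' p.1 + e p.2)))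
    (φ.symm ≪≫ₗ φ' ≪≫ₗ LinearEquiv.piCongrRight ψ ≪≫ₗ
      (LinearEquiv.piCurry A fun (j₁ : J') (j : J) =>
        (restrictComplex f M).homology (k + e' j₁ + e j)).symm ≪≫ₗ
      LinearEquiv.piCongrRight χ)⟩

/-- A shift by `d` in the homology of `B ⊗ P` raises `hsup` by at least `d`, whereas extension of
scalars does not raise `sup`. -/
theorem qpd_le_supDegree_sub_hsupDegree_sub (hf : Function.Surjective f)
    {M : CochainComplex (ModuleCat.{u} B) ℤ} {P : CochainComplex (ModuleCat.{u} A) ℤ}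
    (hP : IsQuasiProjectiveResolution P (restrictComplex f M)) (hPb : IsBoundedAbove P)
    (hM : ¬ M.Acyclic) {J : Type} [Finite J] (e : J → ℤ)
    (he : ∀ k, Nonempty ((restrictComplex f (extendComplex f P)).homology k ≃ₗ[A]
      ∀ j, P.homology (k + e j))) {d : ℕ} {j : J} (hj : e j = d) :
    qpd M ≤ supDegree P - hsupDegree P - (d : EReal) := by
  have : Nonempty J := ⟨j⟩
  have hX : ∀ i, IsZero (P.X i) → IsZero ((extendComplex f P).X i) := fun i hi =>
    (ModuleCat.extendScalars f).map_isZero hi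
  have hPb' : IsBoundedAbove (extendComplex f P) := hPb.imp fun s hs i hi => hX _ (hs i hi)
  obtain ⟨s, h, -, hs, hh, hne⟩ := exists_supDegree_eq hPb
    (hP.not_acyclic hPb (mt (acyclic_restrictComplex_iff _ M).1 hM))
  have hsup : supDegree (extendComplex f P) ≤ supDegree P := by
    refine sSup_le_sSup ?_
    rintro _ ⟨i, hi, rfl⟩
    exact ⟨i, mt (hX _) hi, rfl⟩
  have hhsup : (((h + d : ℤ) : ℝ) : EReal) ≤ hsupDegree (extendComplex f P) := by
    refine le_sSup ⟨h + d, fun hz => hne ?_, rfl⟩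
    rw [← isZero_homology_restrictComplex_iff f] at hz
    obtain ⟨φ⟩ := he (-(h + d))
    rw [ModuleCat.isZero_iff_subsingleton] at hz ⊢
    have h1 : Subsingleton (∀ j, P.homology (-(h + d) + e j)) := φ.symm.toEquiv.subsingleton
    have h2 : Subsingleton (P.homology (-(h + d) + e j)) :=
      (Function.surjective_eval (β := fun j => P.homology (-(h + d) + e j)) j).subsingleton
    rwa [hj, show -(h + (d : ℤ)) + d = -h by ring] at h2
  calc qpd M ≤ supDegree (extendComplex f P) - hsupDegree (extendComplex f P) := by
        rw [qpd, if_neg hM]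
        exact sInf_le ⟨_, hP.extendComplex hf hPb hM e he, hPb', rfl⟩
    _ ≤ supDegree P - (((h + d : ℤ) : ℝ) : EReal) := EReal.sub_le_sub hsup hhsup
    _ = supDegree P - hsupDegree P - (d : EReal) := by
        rw [hs, hh, ← EReal.coe_sub, ← EReal.coe_sub, ← EReal.coe_natCast, ← EReal.coe_sub]
        congr 1
        push_cast
        ring

end Comparison

end QuasiProjective

open QuasiProjective in
theorem mainTheorem9 {R : Type u} [CommRing R] {d : ℕ} (x : Fin d → R)
    (hx : RingTheory.Sequence.IsRegular R (List.ofFn x))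
    (M : CochainComplex (ModuleCat.{u} (R ⧸ QuasiProjective.seqIdeal x)) ℤ)
    (hM : ¬ M.Acyclic) (hMb : QuasiProjective.HasBoundedHomology M) :
    ∃ N : ℕ, ∃ hN : 1 ≤ N, ∀ (n : ℕ) (hn : N ≤ n),
      QuasiProjective.qpd
          (QuasiProjective.restrictComplex
            (Ideal.Quotient.factor (QuasiProjective.seqIdeal_pow_le x (hN.trans hn))) M)
        ≤ QuasiProjective.qpd
            (QuasiProjective.restrictComplex
              (Ideal.Quotient.mk (QuasiProjective.seqIdeal x)) M) - (d : EReal) := by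
  have hMR := mt (acyclic_restrictComplex_iff (Ideal.Quotient.mk (seqIdeal x)) M).1 hM
  obtain htop | ⟨P, hP, hPb, hPq⟩ := qpd_eq_top_or_exists hMR
  · -- The right-hand side is `⊤ - d = ⊤`.
    refine ⟨1, le_rfl, fun n hn => ?_⟩
    rw [htop]
    exact le_of_le_of_eq le_top (EReal.top_sub_coe d).symm
  obtain ⟨w, hw⟩ := hP.exists_homotopy_pow_smul hPb hM hMb
  refine ⟨max 1 w, le_max_left _ _, fun n hn => ?_⟩
  have hn1 : 1 ≤ n := (le_max_left _ _).trans hn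
  obtain ⟨J, _, e, ⟨j, hj⟩, he⟩ := exists_homology_extendComplex_equiv x hx.toIsWeaklyRegular
    hP.1 hn1 fun i => hw (x i) (Ideal.subset_span (Set.mem_range_self i)) n
      ((le_max_right _ _).trans hn)
  rw [hPq]
  rw [restrictComplex_quotient_factor (seqIdeal_pow_le x hn1)] at hP
  exact qpd_le_supDegree_sub_hsupDegree_sub Ideal.Quotient.mk_surjective hP hPb
    (mt (acyclic_restrictComplex_iff _ M).1 hM) e he hj
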